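/- A $K$-variety is a reduced separated scheme of finite type over $K$, and morphisms of $K$-varieties are morphisms over $K$. A field $K$ is existentially closed in an extension $L$ if every finite system of polynomial equations and inequations with coefficients in $K$ that has a solution in $L$ has one in $K$. A (not necessarily algebraic) field extension $L/K$ is regular if it is separable and $K$ is algebraically closed in $L$. The field $K$ is PAC if it is existentially closed in every regular field extension; PRC if it is existentially closed in every regular field extension $L$ such that every field order of $K$ extends to $L$; and pseudofinite if it is perfect, PAC, and has exactly one extension of degree $n$ inside an algebraic closure for each $n \ge 1$. **Proposition.** Let $K$ be a field. Suppose that one of the following holds: 1. $K$ is pseudofinite of characteristic different from $2$; 2. $K$ is PAC of characteristic different from $2$, and some $\beta \in K$ is not a square in $K$; 3. $K$ is PRC and admits at least two distinct field orders. Then there are a $K$-variety $V$ and a proper morphism of $K$-varieties $f \colon V \to \mathbb{A}^1_K$ such that $f(V(K)) = K^\times$, where $\mathbb{A}^1_K(K)$ is identified with $K$. -/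

import Mathlib

open AlgebraicGeometry CategoryTheory

universe u

/-- A field `K` is existentially closed in a `K`-algebra `A`: any finite system of polynomial
equations and inequations over `K` with a solution in `A` has a solution in `K`. -/
def IsExistClosedIn (K A : Type u) [Field K] [CommRing A] [Algebra K A] : Prop :=
  ∀ (n : ℕ) (S T : Finset (MvPolynomial (Fin n) K)),
    (∃ a : Fin n → A, (∀ p ∈ S, MvPolynomial.aeval a p = 0) ∧
      ∀ q ∈ T, MvPolynomial.aeval a q ≠ 0) →
    ∃ b : Fin n → K, (∀ p ∈ S, MvPolynomial.eval b p = 0) ∧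
      ∀ q ∈ T, MvPolynomial.eval b q ≠ 0

/-- A field extension `L / K`, not necessarily algebraic, is regular if it is separable (that is,
`L` stays reduced after base change to an algebraic closure of `K`) and `K` is relatively
algebraically closed in `L`. -/
structure IsRegularExtension (K L : Type u) [Field K] [Field L] [Algebra K L] : Prop where
  separable : Algebra.IsGeometricallyReduced K L
  algebraicClosure_eq : algebraicClosure K L = ⊥

/-- `K` is pseudo-algebraically closed: it is existentially closed in every regular field
extension. -/
def IsPAC (K : Type u) [Field K] : Prop :=
  ∀ (L : Type u) [Field L] [Algebra K L], IsRegularExtension K L → IsExistClosedIn K L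

/-- `K` is pseudofinite: perfect, pseudo-algebraically closed, and with exactly one extension of
each finite degree inside an algebraic closure. -/
structure IsPseudofinite (K : Type u) [Field K] : Prop where
  perfect : PerfectField K
  pac : IsPAC K
  existsUnique_extension : ∀ n : ℕ, 0 < n →
    ∃! E : IntermediateField K (AlgebraicClosure K), Module.finrank K E = n

/-- Every field order of `K` extends to `L`. Field orders are given by their sets of nonnegative
elements. -/
def OrderingsExtend (K L : Type u) [Field K] [Field L] [Algebra K L] : Prop :=
  ∀ P : RingPreordering K, P.IsOrdering →
    ∃ Q : RingPreordering L, Q.IsOrdering ∧ ∀ a : K, algebraMap K L a ∈ Q ↔ a ∈ P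

/-- `K` is pseudo-real closed: it is existentially closed in every regular field extension to
which all field orders of `K` extend. -/
def IsPRC (K : Type u) [Field K] : Prop :=
  ∀ (L : Type u) [Field L] [Algebra K L],
    IsRegularExtension K L → OrderingsExtend K L → IsExistClosedIn K L

/-- A `K`-scheme, given by its structure morphism `s : V ⟶ Spec K`, is a `K`-variety if it is
reduced, separated and of finite type over `K`. -/
structure IsKVariety {K : Type u} [Field K] {V : Scheme.{u}}
    (s : V ⟶ Spec (CommRingCat.of K)) : Prop where
  reduced : IsReduced V
  separated : IsSeparated s
  locallyOfFiniteType : LocallyOfFiniteType s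
  quasiCompact : QuasiCompact s

/-- The affine line over `K`. -/
noncomputable abbrev affineLine (K : Type u) [Field K] : Scheme.{u} :=
  𝔸(PUnit.{u + 1}; Spec (CommRingCat.of K))

/-- The structure morphism of the affine line over `K`. -/
noncomputable abbrev affineLineOver (K : Type u) [Field K] :
    affineLine K ⟶ Spec (CommRingCat.of K) :=
  affineLine K ↘ Spec (CommRingCat.of K)

/-- The `K`-point of the affine line with coordinate `a`. -/
noncomputable def affineLinePoint {K : Type u} [Field K] (a : K) :
    Spec (CommRingCat.of K) ⟶ affineLine K :=
  AffineSpace.homOfVector (𝟙 _) fun _ => (Scheme.ΓSpecIso (CommRingCat.of K)).inv a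

/-- The `K`-rational image `f(V(K))` of a morphism `f : V ⟶ 𝔸¹` of `K`-schemes, as a subset of
`𝔸¹(K) = K`; here `V(K)` is the set of sections of the structure morphism `s : V ⟶ Spec K`. -/
def rationalImage {K : Type u} [Field K] {V : Scheme.{u}} (s : V ⟶ Spec (CommRingCat.of K))
    (f : V ⟶ affineLine K) : Set K :=
  {a | ∃ p : Spec (CommRingCat.of K) ⟶ V, p ≫ s = 𝟙 _ ∧ p ≫ f = affineLinePoint a}

/-! Consider the family `y² = β(u² + γv²)² + a u v³` over the `a`-line, inside the weighted
projective bundle in which `u`, `v` have weight `1` and `y` has weight `2`. It is closed in a proper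
scheme over the line, hence proper. If `β` and `-γ` are nonsquares, the fibre at `a = 0` has no
rational point: `u² + γv²` cannot vanish, so `β` would be a square.

For `a ≠ 0`, put `v = 1` and `f = β(x² + γ)² + a x`. In characteristic not two, `f` is not a
constant times a square in `K(x)`, because its cubic coefficient is zero and its linear one is not.
Hence `K(x)(√f)` is regular over `K` (`isRegularExtension_fibre`), and existential closedness brings
its tautological point `(x, √f)` down to `K`.

If `K` is PAC with a nonsquare `β`, take `γ = -β`. A pseudofinite field has a nonsquare because it
has a quadratic extension. If `K` is PRC, take `β` nonnegative in one ordering and negative in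
another, and `γ = β`: then neither `β` nor `-β` is a square. Every ordering extends to `K(x)(√f)`
because `f` takes a positive value, at `0` or at one of `±√(-β)` (`orderingsExtend_fibre`). -/

/-! ### The weighted projective family of double covers and its rational image. -/

section Geometry

variable (K : Type u) [Field K]

/-- The coordinate ring of the affine line. -/
abbrev LineRing : Type u := MvPolynomial PUnit.{u + 1} K

/-- The grading of `K[t][u, v, y]` in which `u`, `v`, `y` have weights `1`, `1`, `2`. -/
noncomputable def weightGrading : ℕ → Submodule (LineRing K) (MvPolynomial (Fin 3) (LineRing K)) :=
  MvPolynomial.weightedHomogeneousSubmodule (LineRing K) ![1, 1, 2]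

noncomputable instance weightGrading.gradedAlgebra : GradedAlgebra (weightGrading K) :=
  MvPolynomial.weightedGradedAlgebra (LineRing K) ![1, 1, 2]

variable {K}

lemma X_mem_weightGrading (i : Fin 3) :
    (MvPolynomial.X i : MvPolynomial (Fin 3) (LineRing K)) ∈
      weightGrading K ((![1, 1, 2] : Fin 3 → ℕ) i) :=
  MvPolynomial.isWeightedHomogeneous_X _ _ _

instance : Algebra.FiniteType (weightGrading K 0) (MvPolynomial (Fin 3) (LineRing K)) := by
  have : IsScalarTower (LineRing K) (weightGrading K 0) (MvPolynomial (Fin 3) (LineRing K)) :=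
    ⟨fun a b c => smul_mul_assoc a (b : MvPolynomial (Fin 3) (LineRing K)) c⟩
  exact Algebra.FiniteType.of_restrictScalars_finiteType (LineRing K) _ _

variable (K) in
/-- The inclusion of the coordinate ring of the line as the degree zero part. -/
noncomputable def lineRingToZero : LineRing K →+* weightGrading K 0 :=
  algebraMap (LineRing K) (weightGrading K 0)

/-- All weights are positive, so only constants have weight zero. Surjectivity makes `Spec` of this
map a closed immersion, which properness over the line uses. -/
lemma lineRingToZero_surjective : Function.Surjective (lineRingToZero K) := by
  rintro ⟨p, hp⟩
  have hp' : MvPolynomial.IsWeightedHomogeneous (![1, 1, 2] : Fin 3 → ℕ) p 0 := hp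
  have h1 := hp'.weightedHomogeneousComponent_same
  have hw : MvPolynomial.NonTorsionWeight (![1, 1, 2] : Fin 3 → ℕ) :=
    MvPolynomial.nonTorsionWeight_of (by decide)
  rw [MvPolynomial.weightedHomogeneousComponent_zero _ (by decide)] at h1
  exact ⟨_, Subtype.ext h1⟩

variable (K) in
/-- The structure morphism of the weighted projective bundle over the affine line. -/
noncomputable def weightedProjToLine : Proj (weightGrading K) ⟶ affineLine K :=
  Proj.toSpecZero (weightGrading K) ≫
    Spec.map (CommRingCat.ofHom (lineRingToZero K)) ≫
      (AffineSpace.SpecIso PUnit.{u + 1} (CommRingCat.of K)).inv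

instance : IsProper (weightedProjToLine K) := by
  let j : CommRingCat.of (LineRing K) ⟶ CommRingCat.of (weightGrading K 0) :=
    CommRingCat.ofHom (lineRingToZero K)
  have : IsClosedImmersion (Spec.map j) :=
    IsClosedImmersion.spec_of_surjective j lineRingToZero_surjective
  change IsProper (_ ≫ Spec.map j ≫ _)
  infer_instance

lemma affineLinePoint_eq (a : K) :
    affineLinePoint a = Spec.map (CommRingCat.ofHom (MvPolynomial.eval fun _ => a)) ≫
      (AffineSpace.SpecIso PUnit.{u + 1} (CommRingCat.of K)).inv := by
  apply AffineSpace.hom_ext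
  · simp only [affineLinePoint, AffineSpace.homOfVector_over, Category.assoc,
      AffineSpace.SpecIso_inv_over]
    rw [← Spec.map_comp, ← CommRingCat.ofHom_comp]
    have : (MvPolynomial.eval fun _ : PUnit.{u+1} => a).comp MvPolynomial.C = RingHom.id K := by
      ext; simp
    rw [this]
    exact (Spec.map_id _).symm
  · intro i
    rw [affineLinePoint, AffineSpace.homOfVector_appTop_coord, Scheme.Hom.comp_appTop,
      CommRingCat.comp_apply, AffineSpace.SpecIso_inv_appTop_coord]
    refine Eq.trans ?_ (ConcreteCategory.congr_hom (Scheme.ΓSpecIso_inv_naturality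
      (CommRingCat.ofHom (MvPolynomial.eval fun _ : PUnit.{u + 1} => a))) (MvPolynomial.X i))
    change _ = (Scheme.ΓSpecIso (CommRingCat.of K)).inv
      (MvPolynomial.eval (fun _ : PUnit.{u + 1} => a) (MvPolynomial.X i))
    rw [MvPolynomial.eval_X]

lemma affineLinePoint_over (a : K) : affineLinePoint a ≫ affineLineOver K = 𝟙 _ :=
  AffineSpace.homOfVector_over _ _

/-- The equation of the family of double covers. -/
noncomputable def coverEquation (β γ : K) : MvPolynomial (Fin 3) (LineRing K) :=
  MvPolynomial.X 2 ^ 2 -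
    (MvPolynomial.C (MvPolynomial.C β) *
        (MvPolynomial.X 0 ^ 2 + MvPolynomial.C (MvPolynomial.C γ) * MvPolynomial.X 1 ^ 2) ^ 2 +
      MvPolynomial.C (MvPolynomial.X PUnit.unit) * (MvPolynomial.X 0 * MvPolynomial.X 1 ^ 3))

lemma coverEquation_mem (β γ : K) : coverEquation β γ ∈ weightGrading K 4 := by
  have h0 : (MvPolynomial.X 0 : MvPolynomial (Fin 3) (LineRing K)).IsWeightedHomogeneous
    (![1, 1, 2] : Fin 3 → ℕ) 1 := X_mem_weightGrading 0
  have h1 : (MvPolynomial.X 1 : MvPolynomial (Fin 3) (LineRing K)).IsWeightedHomogeneous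
    (![1, 1, 2] : Fin 3 → ℕ) 1 := X_mem_weightGrading 1
  have h2 : (MvPolynomial.X 2 : MvPolynomial (Fin 3) (LineRing K)).IsWeightedHomogeneous
    (![1, 1, 2] : Fin 3 → ℕ) 2 := X_mem_weightGrading 2
  exact (h2.pow 2).sub (((((h0.pow 2).add ((h1.pow 2).C_mul _)).pow 2).C_mul _).add
    ((h0.mul (h1.pow 3)).C_mul _))

/-- The closed subset of the weighted projective bundle cut out by `coverEquation`. -/
noncomputable def coverLocus (β γ : K) : TopologicalSpace.Closeds (Proj (weightGrading K)) :=
  (Proj.basicOpen (weightGrading K) (coverEquation β γ)).compl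

/-- The family of double covers, with its reduced structure. -/
noncomputable abbrev coverVariety (β γ : K) : Scheme.{u} :=
  (Scheme.IdealSheafData.vanishingIdeal (coverLocus β γ)).subscheme

/-- The family of double covers as a scheme over the affine line. -/
noncomputable def coverToLine (β γ : K) : coverVariety β γ ⟶ affineLine K :=
  (Scheme.IdealSheafData.vanishingIdeal (coverLocus β γ)).subschemeι ≫ weightedProjToLine K

instance (β γ : K) : IsProper (coverToLine β γ) := by
  unfold coverToLine
  infer_instance

lemma isReduced_subscheme_of_isRadical {X : Scheme.{u}} (I : X.IdealSheafData)
    (hI : ∀ U, (I.ideal U).IsRadical) : IsReduced I.subscheme := by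
  rw [IsReduced.iff_of_openCover _ I.subschemeCover.openCover]
  intro (U : X.affineOpens)
  have : _root_.IsReduced (Γ(X, U.1) ⧸ I.ideal U) :=
    (Ideal.isRadical_iff_quotient_reduced _).mp (hI U)
  change IsReduced (Spec (CommRingCat.of (Γ(X, U.1) ⧸ I.ideal U)))
  infer_instance

instance (β γ : K) : IsReduced (coverVariety β γ) := by
  refine isReduced_subscheme_of_isRadical _ fun U => ?_
  rw [Scheme.IdealSheafData.vanishingIdeal_ideal]
  exact PrimeSpectrum.isRadical_vanishingIdeal _

lemma coverToLine_isKVariety (β γ : K) :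
    IsKVariety (coverToLine β γ ≫ affineLineOver K) where
  reduced := inferInstance
  separated := inferInstance
  locallyOfFiniteType := inferInstance
  quasiCompact := inferInstance

/-- A point of a scheme with values in a reduced scheme factors through the reduced closed
subscheme on any closed subset that contains its range. -/
lemma exists_lift_vanishingIdeal {X Y : Scheme.{u}} [IsReduced Y] (p : Y ⟶ X) [QuasiCompact p]
    (Z : TopologicalSpace.Closeds X) (h : Set.range p ⊆ Z) :
    ∃ q : Y ⟶ (Scheme.IdealSheafData.vanishingIdeal Z).subscheme,
      q ≫ (Scheme.IdealSheafData.vanishingIdeal Z).subschemeι = p := by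
  have hle : Scheme.IdealSheafData.vanishingIdeal Z ≤ p.ker := by
    have hs : p.ker.support ≤ Z := by
      rw [← SetLike.coe_subset_coe, Scheme.Hom.support_ker]
      exact Z.isClosed.closure_subset_iff.mpr h
    refine (Scheme.IdealSheafData.vanishingIdeal_antimono hs).trans ?_
    -- The vanishing ideal of the support is the radical of the kernel, and the kernel is already
    -- radical because `Y` is reduced.
    rw [Scheme.IdealSheafData.vanishingIdeal_support]
    intro U x hx
    obtain ⟨n, hn⟩ := hx
    rw [Scheme.Hom.ker_apply, RingHom.mem_ker, map_pow] at hn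
    rw [Scheme.Hom.ker_apply, RingHom.mem_ker]
    exact eq_zero_of_pow_eq_zero hn
  exact ⟨IsClosedImmersion.lift (Scheme.IdealSheafData.vanishingIdeal Z).subschemeι p
    (by rwa [Scheme.IdealSheafData.ker_subschemeι]), IsClosedImmersion.lift_fac _ _ _⟩

lemma coverEquation_map (β γ : K) {S : Type*} [CommRing S]
    (φ : MvPolynomial (Fin 3) (LineRing K) →+* S) :
    φ (coverEquation β γ) = φ (.X 2) ^ 2 -
      (φ (.C (.C β)) * (φ (.X 0) ^ 2 + φ (.C (.C γ)) * φ (.X 1) ^ 2) ^ 2 +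
        φ (.C (.X PUnit.unit)) * (φ (.X 0) * φ (.X 1) ^ 3)) := by
  simp [coverEquation]

/-- The `K`-point of the weighted projective bundle over `a` with homogeneous coordinates `c`. -/
lemma exists_weightedProj_point (a : K) (c : Fin 3 → K) (hc : c 0 ≠ 0 ∨ c 1 ≠ 0) :
    ∃ p : Spec (CommRingCat.of K) ⟶ Proj (weightGrading K),
      p ≫ weightedProjToLine K = affineLinePoint a ∧
        ∀ n, 0 < n → ∀ g ∈ weightGrading K n,
          MvPolynomial.eval₂ (MvPolynomial.eval fun _ => a) c g = 0 →
            ∀ x, p x ∉ Proj.basicOpen (weightGrading K) g := by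
  let φ₀ : MvPolynomial (Fin 3) (LineRing K) →+* K :=
    MvPolynomial.eval₂Hom (MvPolynomial.eval fun _ => a) c
  let φ : MvPolynomial (Fin 3) (LineRing K) →+* Γ(Spec (CommRingCat.of K), ⊤) :=
    (Scheme.ΓSpecIso (CommRingCat.of K)).inv.hom.comp φ₀
  -- A nonzero coordinate is a unit in the image of the irrelevant ideal, which is what a map to
  -- `Proj` requires.
  have key : ∀ i : Fin 3, c i ≠ 0 →
      (HomogeneousIdeal.irrelevant (weightGrading K)).toIdeal.map φ = ⊤ := by
    intro i hi
    refine Ideal.eq_top_of_isUnit_mem _ (x := φ (.X i)) (Ideal.mem_map_of_mem _ ?_) ?_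
    · change GradedRing.proj (weightGrading K) 0 _ = 0
      rw [GradedRing.proj_apply]
      refine DirectSum.decompose_of_mem_ne _ (X_mem_weightGrading i) ?_
      fin_cases i <;> decide
    · have : φ₀ (.X i) = c i := by simp [φ₀]
      have h' : IsUnit (φ₀ (.X i)) := by rw [this]; exact hi.isUnit
      exact h'.map (Scheme.ΓSpecIso (CommRingCat.of K)).inv.hom
  have hφ := hc.elim (key 0) (key 1)
  refine ⟨Proj.fromOfGlobalSections _ φ hφ, ?_, fun n hn g hg h0 x hx => ?_⟩
  · rw [affineLinePoint_eq, weightedProjToLine, Proj.fromOfGlobalSections_toSpecZero_assoc]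
    rw [← Spec.map_comp_assoc, ← CommRingCat.ofHom_comp]
    have h1 : (φ.comp (algebraMap (weightGrading K 0) _)).comp (lineRingToZero K) =
        (Scheme.ΓSpecIso (CommRingCat.of K)).inv.hom.comp (MvPolynomial.eval fun _ => a) := by
      refine RingHom.ext fun r => ?_
      change (Scheme.ΓSpecIso (CommRingCat.of K)).inv.hom (φ₀ (MvPolynomial.C r)) = _
      simp [φ₀]
    rw [h1, CommRingCat.ofHom_comp, Spec.map_comp]
    simp
  · have hx' : x ∈ Proj.fromOfGlobalSections _ φ hφ ⁻¹ᵁ Proj.basicOpen (weightGrading K) g := hx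
    rw [Proj.fromOfGlobalSections_preimage_basicOpen _ φ hφ hn hg] at hx'
    have : φ g = 0 := by
      change (Scheme.ΓSpecIso (CommRingCat.of K)).inv.hom (φ₀ g) = 0
      simp [φ₀, h0]
    simp [this] at hx'

/-- Homogeneous coordinates of a `K`-point in a standard chart of weight one. -/
lemma exists_coordinates_of_mem_basicOpen (a : K)
    (p : Spec (CommRingCat.of K) ⟶ Proj (weightGrading K))
    (hp : p ≫ weightedProjToLine K = affineLinePoint a) (i : Fin 3)
    (hi : (MvPolynomial.X i : MvPolynomial (Fin 3) (LineRing K)) ∈ weightGrading K 1)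
    (hpi : ∀ x, p x ∈ Proj.basicOpen (weightGrading K) (.X i)) :
    ∃ c : Fin 3 → K, c i = 1 ∧ ∀ g ∈ weightGrading K 4,
      (∀ x, p x ∉ Proj.basicOpen (weightGrading K) g) →
        MvPolynomial.eval₂ (MvPolynomial.eval fun _ => a) c g = 0 := by
  have hrange : Set.range p ⊆ Set.range (Proj.awayι (weightGrading K) (.X i) hi one_pos) := by
    rintro _ ⟨x, rfl⟩
    have := hpi x
    rw [← Proj.opensRange_awayι (weightGrading K) (.X i) hi one_pos] at this
    exact this
  obtain ⟨q, hq⟩ : ∃ q, q ≫ Proj.awayι (weightGrading K) (.X i) hi one_pos = p :=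
    ⟨_, IsOpenImmersion.lift_fac _ p hrange⟩
  obtain ⟨ψ, rfl⟩ := Spec.map_surjective q
  have hψa : (ψ.hom.comp (HomogeneousLocalization.fromZeroRingHom (weightGrading K) _)).comp
      (lineRingToZero K) = MvPolynomial.eval fun _ => a := by
    rw [affineLinePoint_eq, weightedProjToLine, ← hq, Category.assoc, Proj.awayι_toSpecZero_assoc,
      ← Category.assoc, ← Category.assoc, cancel_mono, ← Spec.map_comp,
      ← Spec.map_comp] at hp
    have := congrArg CommRingCat.Hom.hom (Spec.map_injective hp)
    exact this
  -- Dehomogenization: `Θ` sends `X j` to `X j / X i ^ w j`, with `w j` the weight of `X j`. Since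
  -- `X i` has weight one, a form `g` of weight `n` satisfies `g = X i ^ n * Θ g` after inverting `X
  -- i`.
  let Θ : MvPolynomial (Fin 3) (LineRing K) →+*
      HomogeneousLocalization.Away (weightGrading K) (.X i) :=
    MvPolynomial.eval₂Hom ((HomogeneousLocalization.fromZeroRingHom (weightGrading K) _).comp
      (lineRingToZero K)) fun j =>
        HomogeneousLocalization.Away.mk _ hi ((![1, 1, 2] : Fin 3 → ℕ) j) (.X j)
          (by simpa using X_mem_weightGrading j)
  let loc : MvPolynomial (Fin 3) (LineRing K) →+*
      Localization.Away (MvPolynomial.X i : MvPolynomial (Fin 3) (LineRing K)) := algebraMap _ _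
  have hloc : ∀ g, loc g = Localization.mk g 1 := fun g =>
    (Localization.mk_one_eq_algebraMap g).symm
  have hΘX : ∀ j, loc (MvPolynomial.X j) =
        loc (MvPolynomial.X i) ^ ((![1, 1, 2] : Fin 3 → ℕ) j) *
          (Θ (MvPolynomial.X j)).val := by
    intro j
    simp only [Θ, MvPolynomial.coe_eval₂Hom, MvPolynomial.eval₂_X,
      HomogeneousLocalization.Away.val_mk]
    rw [← map_pow, hloc, hloc,
      Localization.mk_mul, Localization.mk_eq_mk_iff, Localization.r_iff_exists]
    exact ⟨1, by simp⟩
  have hΘmon : ∀ (d : Fin 3 →₀ ℕ) (r : LineRing K), loc (MvPolynomial.monomial d r) =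
        loc (MvPolynomial.X i) ^ (Finsupp.weight (![1, 1, 2] : Fin 3 → ℕ) d) *
          (Θ (MvPolynomial.monomial d r)).val := by
    have hC : ∀ r : LineRing K, loc (MvPolynomial.C r) =
          (Θ (MvPolynomial.C r)).val := by
      intro r
      simp only [Θ, MvPolynomial.coe_eval₂Hom, MvPolynomial.eval₂_C]
      rfl
    intro d
    induction d using Finsupp.induction_linear with
    | zero => intro r; simpa using hC r
    | add d e hd he =>
      intro r
      rw [← mul_one r, ← MvPolynomial.monomial_mul, map_mul, map_mul, hd, he,
        HomogeneousLocalization.val_mul, map_add, pow_add]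
      ring
    | single j m =>
      intro r
      rw [← MvPolynomial.C_mul_X_pow_eq_monomial, map_mul, map_mul, map_pow, map_pow, hC, hΘX,
        HomogeneousLocalization.val_mul, HomogeneousLocalization.val_pow,
        Finsupp.weight_single, smul_eq_mul, mul_comm m, pow_mul]
      ring
  have hΘ : ∀ (n : ℕ) (g), MvPolynomial.IsWeightedHomogeneous (![1, 1, 2] : Fin 3 → ℕ) g n →
      loc g =
        loc (MvPolynomial.X i) ^ n * (Θ g).val := by
    intro n g hg
    induction hg using MvPolynomial.IsWeightedHomogeneous.induction_on with
    | zero => simp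
    | add p q _ _ hp hq =>
      rw [map_add, map_add, HomogeneousLocalization.val_add, hp, hq, mul_add]
    | monomial d r hr => rw [hΘmon, hr]
  have hunit : IsUnit (loc (MvPolynomial.X i)) :=
    IsLocalization.Away.algebraMap_isUnit _
  have hψΘ : ψ.hom.comp Θ =
      MvPolynomial.eval₂Hom (MvPolynomial.eval fun _ => a) fun j => ψ.hom (Θ (.X j)) := by
    refine MvPolynomial.ringHom_ext (fun r => ?_) fun j => by simp
    have := RingHom.congr_fun hψa r
    simpa [Θ] using this
  refine ⟨fun j => ψ.hom (Θ (.X j)), ?_, fun g hg hpg => ?_⟩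
  · have h1 : Θ (.X i) = 1 := by
      apply HomogeneousLocalization.val_injective
      have := hΘ 1 _ hi
      rw [pow_one, eq_comm, hunit.mul_eq_left] at this
      rw [this, HomogeneousLocalization.val_one]
    simp [h1]
  · have h2 : Θ g = HomogeneousLocalization.Away.isLocalizationElem hi hg := by
      apply HomogeneousLocalization.val_injective
      apply (hunit.pow 4).mul_left_cancel
      rw [← hΘ 4 g hg, HomogeneousLocalization.Away.val_mk, ← map_pow, hloc, hloc,
        Localization.mk_mul, Localization.mk_eq_mk_iff, Localization.r_iff_exists]
      exact ⟨1, by simp⟩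
    have h3 := RingHom.congr_fun hψΘ g
    change ψ.hom (Θ g) = MvPolynomial.eval₂ _ _ g at h3
    rw [← h3, h2]
    by_contra hne
    let x : Spec (CommRingCat.of K) := IsLocalRing.closedPoint K
    apply hpg x
    rw [← hq]
    change Spec.map ψ x ∈ Proj.awayι _ _ hi one_pos ⁻¹ᵁ Proj.basicOpen _ g
    rw [Proj.awayι_preimage_basicOpen (weightGrading K) hi one_pos hg (by norm_num)]
    intro hmem
    change ψ.hom _ ∈ IsLocalRing.maximalIdeal K at hmem
    rw [IsLocalRing.mem_maximalIdeal] at hmem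
    exact hmem (isUnit_iff_ne_zero.mpr hne)

lemma iSup_basicOpen_X_eq_top :
    ⨆ i, Proj.basicOpen (weightGrading K) (MvPolynomial.X i) = ⊤ := by
  refine Proj.iSup_basicOpen_eq_top' _ _ (fun i => ⟨_, X_mem_weightGrading i⟩) ?_
  rw [eq_top_iff]
  rintro p -
  induction p using MvPolynomial.induction_on with
  | C r => exact Subalgebra.algebraMap_mem _ (lineRingToZero K r)
  | add p q hp hq => exact add_mem hp hq
  | mul_X p i hp => exact mul_mem hp (Algebra.subset_adjoin ⟨i, rfl⟩)

/-- The rational image of the family of double covers. -/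
lemma rationalImage_coverToLine (β γ : K) :
    rationalImage (coverToLine β γ ≫ affineLineOver K) (coverToLine β γ) =
      {a | ∃ u v y : K, (u ≠ 0 ∨ v ≠ 0) ∧
        y ^ 2 = β * (u ^ 2 + γ * v ^ 2) ^ 2 + a * (u * v ^ 3)} := by
  ext a
  constructor
  · rintro ⟨p, -, hp⟩
    set ι := (Scheme.IdealSheafData.vanishingIdeal (coverLocus β γ)).subschemeι with hι
    have hp' : (p ≫ ι) ≫ weightedProjToLine K = affineLinePoint a := by
      rw [Category.assoc]; exact hp
    have hZ : ∀ x, (p ≫ ι) x ∉ Proj.basicOpen (weightGrading K) (coverEquation β γ) := by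
      intro x
      have h1 : (p ≫ ι) x ∈ Set.range ι := ⟨p x, rfl⟩
      rw [hι, Scheme.IdealSheafData.range_subschemeι,
        Scheme.IdealSheafData.coe_support_vanishingIdeal] at h1
      exact h1
    -- As `Spec K` has one point, a rational point lies entirely in a single chart.
    have huniq : ∀ x y : Spec (CommRingCat.of K), x = y :=
      fun x y => (inferInstance : Subsingleton (PrimeSpectrum K)).elim x y
    let x₀ : Spec (CommRingCat.of K) := IsLocalRing.closedPoint K
    have hfin : ∀ i : Fin 3, i = 0 ∨ i = 1 →
        (p ≫ ι) x₀ ∈ Proj.basicOpen (weightGrading K) (.X i) → ∃ u v y : K, (u ≠ 0 ∨ v ≠ 0) ∧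
        y ^ 2 = β * (u ^ 2 + γ * v ^ 2) ^ 2 + a * (u * v ^ 3) := by
      intro i hi hx
      have hXi : (MvPolynomial.X i : MvPolynomial (Fin 3) (LineRing K)) ∈ weightGrading K 1 := by
        obtain rfl | rfl := hi
        · exact X_mem_weightGrading 0
        · exact X_mem_weightGrading 1
      obtain ⟨c, hc, hg⟩ := exists_coordinates_of_mem_basicOpen a (p ≫ ι) hp' i hXi
        fun x => huniq x₀ x ▸ hx
      have h0 := hg _ (coverEquation_mem β γ) hZ
      rw [← MvPolynomial.coe_eval₂Hom, coverEquation_map] at h0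
      refine ⟨c 0, c 1, c 2, ?_, ?_⟩
      · obtain rfl | rfl := hi
        · exact Or.inl (hc ▸ one_ne_zero)
        · exact Or.inr (hc ▸ one_ne_zero)
      · simpa [sub_eq_zero] using h0
    have hcover : (p ≫ ι) x₀ ∈ ⨆ i, Proj.basicOpen (weightGrading K) (.X i) := by
      rw [iSup_basicOpen_X_eq_top]; trivial
    obtain ⟨i, hi⟩ := TopologicalSpace.Opens.mem_iSup.mp hcover
    by_cases h0 : (p ≫ ι) x₀ ∈ Proj.basicOpen (weightGrading K) (.X 0)
    · exact hfin 0 (.inl rfl) h0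
    by_cases h1 : (p ≫ ι) x₀ ∈ Proj.basicOpen (weightGrading K) (.X 1)
    · exact hfin 1 (.inr rfl) h1
    -- If `u` and `v` both lie in the homogeneous prime of the point, the equation puts `y²`, hence
    -- `y`, there too. So the charts of weight one already cover the family.
    exfalso
    have h2 : (p ≫ ι) x₀ ∈ Proj.basicOpen (weightGrading K) (.X 2) := by
      fin_cases i
      · exact (h0 hi).elim
      · exact (h1 hi).elim
      · exact hi
    have hg := hZ x₀
    rw [Proj.mem_basicOpen, not_not] at h0 h1 hg
    rw [Proj.mem_basicOpen] at h2
    set P := ((p ≫ ι) x₀).asHomogeneousIdeal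
    have hP : P.toIdeal.IsPrime := ((p ≫ ι) x₀).isPrime
    have hq := fun z => Ideal.Quotient.eq_zero_iff_mem (I := P.toIdeal) (a := z)
    refine h2 (hP.mem_of_pow_mem 2 ((hq _).mp ?_))
    have e0 := (hq _).mpr h0
    have e1 := (hq _).mpr h1
    have eg := (hq _).mpr hg
    rw [coverEquation_map, e0, e1] at eg
    simpa using eg
  · rintro ⟨u, v, y, huv, hy⟩
    obtain ⟨p, hp, hg⟩ := exists_weightedProj_point a ![u, v, y] huv
    obtain ⟨q, hq⟩ := exists_lift_vanishingIdeal p (coverLocus β γ) (by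
      rintro _ ⟨x, rfl⟩
      refine hg 4 (by norm_num) _ (coverEquation_mem β γ) ?_ x
      rw [← MvPolynomial.coe_eval₂Hom, coverEquation_map]
      simp [hy])
    have hq' : q ≫ coverToLine β γ = affineLinePoint a := by
      rw [coverToLine, ← Category.assoc, hq, hp]
    refine ⟨q, ?_, hq'⟩
    rw [← Category.assoc, hq']
    exact affineLinePoint_over a

end Geometry

/-! ### Regularity of the function fields of the fibres. -/

section FieldTheory

open Polynomial

/-- An element of `K(X)` whose square is a polynomial is a polynomial. -/
lemma exists_polynomial_of_sq {K : Type u} [Field K] (g : RatFunc K) (p : K[X])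
    (h : g ^ 2 = algebraMap K[X] (RatFunc K) p) : ∃ q : K[X], algebraMap K[X] (RatFunc K) q = g := by
  refine IsIntegrallyClosed.exists_algebraMap_eq_of_isIntegral_pow (n := 2) two_pos ?_
  rw [h]
  exact isIntegral_algebraMap

/-- The right hand side of the equation of the fibre at `a` of the family of double covers. -/
noncomputable def fibrePoly {K : Type u} [Field K] (β γ a : K) : K[X] :=
  C β * (X ^ 2 + C γ) ^ 2 + C a * X

lemma eval_fibrePoly {K : Type u} [Field K] (β γ a x : K) :
    (fibrePoly β γ a).eval x = β * (x ^ 2 + γ) ^ 2 + a * x := by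
  simp [fibrePoly]

lemma exists_fibrePoly_eq {K : Type u} [Field K] (β γ a : K) :
    ∃ r s, fibrePoly β γ a = C β * X ^ 4 + C r * X ^ 2 + C a * X + C s := by
  refine ⟨2 * β * γ, β * γ ^ 2, ?_⟩
  simp only [fibrePoly, map_mul, map_pow, map_ofNat]
  ring

/-- Such a `q` has degree at most two. The vanishing cubic coefficient gives `2 q₁ q₂ = 0` with `q₂
≠ 0`, so `q₁ = 0`; then the linear coefficient `a` would vanish. -/
lemma fibrePoly_ne_C_mul_sq {K : Type u} [Field K] {β γ a : K} (h2 : (2 : K) ≠ 0) (hβ : β ≠ 0)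
    (ha : a ≠ 0) (c : K) (q : K[X]) : fibrePoly β γ a ≠ C c * q ^ 2 := by
  intro h
  obtain ⟨r, s, hrs⟩ := exists_fibrePoly_eq β γ a
  have hc : c ≠ 0 := by
    rintro rfl
    have h1 := congrArg (coeff · 1) h
    simp [hrs, coeff_C] at h1
    exact ha h1
  have hdeg : q.natDegree ≤ 2 := by
    have h1 : (fibrePoly β γ a).natDegree ≤ 4 := by
      rw [hrs]
      compute_degree
    rw [h, natDegree_C_mul hc, natDegree_pow] at h1
    omega
  have hq3 : q.coeff 3 = 0 := coeff_eq_zero_of_natDegree_lt (by omega)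
  have hq4 : q.coeff 4 = 0 := coeff_eq_zero_of_natDegree_lt (by omega)
  have e1 := congrArg (coeff · 1) h
  have e3 := congrArg (coeff · 3) h
  have e4 := congrArg (coeff · 4) h
  simp [hrs, coeff_X, coeff_C, pow_two q, coeff_mul, Finset.Nat.antidiagonal_succ, hq3, hq4] at e1 e3 e4
  have hq2 : q.coeff 2 ≠ 0 := by
    intro h0
    apply hβ
    rw [e4, h0]
    ring
  have hq1 : q.coeff 1 = 0 := by
    have : 2 * q.coeff 1 * q.coeff 2 = 0 := by
      have := e3.resolve_left hc
      linear_combination this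
    simpa [h2, hq2] using this
  apply ha
  rw [e1, hq1]
  ring

/-- For `c ≠ 0`, `g²` is the polynomial `c⁻¹ f`, so `g` is itself a polynomial, `K[X]` being
integrally closed. -/
lemma algebraMap_fibrePoly_ne {K : Type u} [Field K] {β γ a : K} (h2 : (2 : K) ≠ 0) (hβ : β ≠ 0)
    (ha : a ≠ 0) (c : K) (g : RatFunc K) :
    algebraMap K[X] (RatFunc K) (fibrePoly β γ a) ≠ algebraMap K (RatFunc K) c * g ^ 2 := by
  intro h
  rw [IsScalarTower.algebraMap_apply K K[X] (RatFunc K), Polynomial.algebraMap_eq] at h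
  by_cases hc : c = 0
  · subst hc
    have : fibrePoly β γ a = C 0 * 1 ^ 2 := by
      apply IsFractionRing.injective K[X] (RatFunc K)
      rw [h]
      simp
    exact fibrePoly_ne_C_mul_sq h2 hβ ha _ _ this
  obtain ⟨q, rfl⟩ := exists_polynomial_of_sq g (C c⁻¹ * fibrePoly β γ a) (by
    rw [map_mul, h, ← mul_assoc, ← map_mul, ← C_mul, inv_mul_cancel₀ hc]
    simp)
  rw [← map_pow, ← map_mul] at h
  exact fibrePoly_ne_C_mul_sq h2 hβ ha c q (IsFractionRing.injective K[X] (RatFunc K) h)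

/-- Let `E / K` be an extension in which `K` is relatively algebraically closed. If `F` is not a
constant times a square in `E`, then `K` is relatively algebraically closed in `E(√F)`. -/
lemma mem_range_of_isAlgebraic_quadraticAlgebra {K E : Type u} [Field K] [Field E] [Algebra K E]
    (h2 : (2 : K) ≠ 0) (hE : ∀ x : E, IsAlgebraic K x → x ∈ (algebraMap K E).range) {F : E}
    (hF : ∀ (c : K) (g : E), F ≠ algebraMap K E c * g ^ 2)
    [Fact (∀ r : E, r ^ 2 ≠ F + 0 * r)] (x : QuadraticAlgebra E F 0) (hx : IsAlgebraic K x) :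
    x ∈ (algebraMap K (QuadraticAlgebra E F 0)).range := by
  let σ : QuadraticAlgebra E F 0 →ₐ[K] QuadraticAlgebra E F 0 :=
    { starRingEnd (QuadraticAlgebra E F 0) with
      commutes' := fun r => by
        rw [IsScalarTower.algebraMap_apply K E]
        change star _ = _
        ext <;> simp }
  have h2E : (2 : E) ≠ 0 := by
    rw [← map_ofNat (algebraMap K E)]; exact (_root_.map_ne_zero _).mpr h2
  have hσ : IsAlgebraic K (star x) := hx.algHom σ
  -- The conjugate of `x` is algebraic too, so half the trace of `x` is algebraic, and so is the
  -- square of `x` minus that half trace.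
  have hre : IsAlgebraic K x.re := by
    have h3 := hx.add hσ
    have h4 : x + star x = algebraMap E _ (2 * x.re) := by ext <;> simp; ring
    rw [h4, isAlgebraic_algebraMap_iff (algebraMap E (QuadraticAlgebra E F 0)).injective] at h3
    have h5 := (isAlgebraic_algebraMap (A := E) (2⁻¹ : K)).mul h3
    have h6 : algebraMap K E 2⁻¹ * (2 * x.re) = x.re := by
      rw [map_inv₀, map_ofNat]
      field_simp
    rwa [h6] at h5
  have him : IsAlgebraic K (x.im ^ 2 * F) := by
    have h3 := (hx.sub (hre.algebraMap (A := QuadraticAlgebra E F 0))).pow 2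
    have h4 : (x - algebraMap E _ x.re) ^ 2 = algebraMap E (QuadraticAlgebra E F 0)
        (x.im ^ 2 * F) := by
      ext <;> simp [pow_two]; ring
    rwa [h4, isAlgebraic_algebraMap_iff (algebraMap E (QuadraticAlgebra E F 0)).injective] at h3
  obtain ⟨a, ha⟩ := hE _ hre
  obtain ⟨c, hc⟩ := hE _ him
  -- Otherwise `F = c * (x.im⁻¹)²` with `c` in `K`.
  have him0 : x.im = 0 := by
    by_contra h0
    apply hF c x.im⁻¹
    rw [hc]
    field_simp
  refine ⟨a, ?_⟩
  rw [IsScalarTower.algebraMap_apply K E]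
  ext
  · simp [ha]
  · simp [him0]

lemma mem_range_of_isAlgebraic_ratFunc {K : Type u} [Field K] (x : RatFunc K)
    (hx : IsAlgebraic K x) : x ∈ (algebraMap K (RatFunc K)).range := by
  by_contra h
  refine RatFunc.transcendental_of_ne_C x (fun ⟨c, hc⟩ => h ⟨c, ?_⟩) hx
  rw [hc]
  rfl

open TensorProduct in
/-- Adjoining a square root in characteristic not two preserves geometric reducedness. -/
lemma isGeometricallyReduced_quadraticAlgebra {K E : Type u} [Field K] [Field E] [Algebra K E]
    [Algebra.IsGeometricallyReduced K E] (h2 : (2 : K) ≠ 0) {F : E} (hF : F ≠ 0) :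
    Algebra.IsGeometricallyReduced K (QuadraticAlgebra E F 0) := by
  rw [Algebra.isGeometricallyReduced_field_iff]
  let Ω := AlgebraicClosure K
  let L := QuadraticAlgebra E F 0
  have hred : _root_.IsReduced (Ω ⊗[K] E) := inferInstance
  let ι : Ω ⊗[K] E →ₐ[K] Ω ⊗[K] L :=
    Algebra.TensorProduct.map (AlgHom.id K Ω) (IsScalarTower.toAlgHom K E L)
  let ω : Ω ⊗[K] L := 1 ⊗ₜ QuadraticAlgebra.omega
  let re : Ω ⊗[K] L →ₗ[K] Ω ⊗[K] E :=
    ((QuadraticAlgebra.reₗ (a := F) (b := 0)).restrictScalars K).lTensor Ω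
  let im : Ω ⊗[K] L →ₗ[K] Ω ⊗[K] E :=
    ((QuadraticAlgebra.imₗ (a := F) (b := 0)).restrictScalars K).lTensor Ω
  have hre : ∀ a b, re (ι a + ι b * ω) = a := by
    intro a b
    have h1 : re (ι a) = a := by
      induction a with
      | zero => simp
      | tmul w e => simp [re, ι, L]
      | add x y hx hy => rw [map_add, map_add, hx, hy]
    have h3 : re (ι b * ω) = 0 := by
      induction b with
      | zero => simp
      | tmul w e => simp [re, ι, ω, L]
      | add x y hx hy => rw [map_add, add_mul, map_add, hx, hy, add_zero]
    rw [map_add, h1, h3, add_zero]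
  have him : ∀ a b, im (ι a + ι b * ω) = b := by
    intro a b
    have h1 : im (ι a) = 0 := by
      induction a with
      | zero => simp
      | tmul w e => simp [im, ι, L]
      | add x y hx hy => rw [map_add, map_add, hx, hy, add_zero]
    have h3 : im (ι b * ω) = b := by
      induction b with
      | zero => simp
      | tmul w e => simp [im, ι, ω, L]
      | add x y hx hy => rw [map_add, add_mul, map_add, hx, hy]
    rw [map_add, h1, h3, zero_add]
  have hex : ∀ z : Ω ⊗[K] L, ∃ a b, z = ι a + ι b * ω := by
    intro z
    induction z with
    | zero => exact ⟨0, 0, by simp⟩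
    | tmul w x =>
      refine ⟨w ⊗ₜ x.re, w ⊗ₜ x.im, ?_⟩
      simp only [ι, ω, Algebra.TensorProduct.map_tmul, Algebra.TensorProduct.tmul_mul_tmul, mul_one,
        ← TensorProduct.tmul_add, AlgHom.id_apply]
      congr 1
      ext <;> simp [L]
    | add x y hx hy =>
      obtain ⟨a, b, rfl⟩ := hx
      obtain ⟨c, d, rfl⟩ := hy
      exact ⟨a + c, b + d, by rw [map_add, map_add]; ring⟩
  have hω : ω * ω = ι (1 ⊗ₜ F) := by
    simp only [ι, ω, Algebra.TensorProduct.map_tmul, Algebra.TensorProduct.tmul_mul_tmul, map_one,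
      mul_one]
    congr 1
    ext <;> simp [L]
  have hunit : IsUnit ((1 : Ω) ⊗ₜ[K] F) :=
    (isUnit_iff_ne_zero.mpr hF).map (Algebra.TensorProduct.includeRight : E →ₐ[K] Ω ⊗[K] E)
  have h2u : IsUnit (2 : Ω ⊗[K] E) := by
    rw [← map_ofNat (algebraMap K (Ω ⊗[K] E))]
    exact (isUnit_iff_ne_zero.mpr h2).map _
  -- If `(a + bω)² = 0`, then `a² + b²F = 0` and `2ab = 0`. As `2` and `F` are units, this yields
  -- `ab = 0`, then `a³ = 0`, and finally `b² = 0`.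
  refine (isReduced_iff_pow_one_lt 2 one_lt_two).mpr fun z hz => ?_
  obtain ⟨a, b, rfl⟩ := hex z
  have hsq : (ι a + ι b * ω) ^ 2 = ι (a ^ 2 + b ^ 2 * (1 ⊗ₜ F)) + ι (2 * (a * b)) * ω := by
    simp only [map_add, map_mul, map_pow, map_ofNat, ← hω]
    ring
  rw [hsq] at hz
  have ha := hre (a ^ 2 + b ^ 2 * (1 ⊗ₜ F)) (2 * (a * b))
  have hb := him (a ^ 2 + b ^ 2 * (1 ⊗ₜ F)) (2 * (a * b))
  rw [hz, map_zero] at ha hb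
  have hab : a * b = 0 := h2u.mul_right_eq_zero.mp hb.symm
  have ha0 : a = 0 := by
    refine eq_zero_of_pow_eq_zero (n := 3) ?_
    linear_combination -a * ha - b * (1 ⊗ₜ F) * hab
  have hb0 : b = 0 := by
    refine eq_zero_of_pow_eq_zero (n := 2) (hunit.mul_left_eq_zero.mp ?_)
    rw [ha0] at ha
    linear_combination -ha
  simp [ha0, hb0]

-- After multiplication by a denominator, which is a unit, every element of `Ω ⊗ K(X)` comes from
-- the subring `Ω ⊗ K[X] ≅ Ω[X]`, which is reduced.
open TensorProduct in
lemma isGeometricallyReduced_ratFunc (K : Type u) [Field K] :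
    Algebra.IsGeometricallyReduced K (RatFunc K) := by
  rw [Algebra.isGeometricallyReduced_field_iff]
  let Ω := AlgebraicClosure K
  have hred : _root_.IsReduced (Ω ⊗[K] K[X]) :=
    isReduced_of_injective (polyEquivTensor K Ω).symm (polyEquivTensor K Ω).symm.injective
  let ι : Ω ⊗[K] K[X] →ₐ[K] Ω ⊗[K] RatFunc K :=
    Algebra.TensorProduct.map (AlgHom.id K Ω) (IsScalarTower.toAlgHom K K[X] (RatFunc K))
  have hι : Function.Injective ι :=
    Module.Flat.lTensor_preserves_injective_linearMap
      (IsScalarTower.toAlgHom K K[X] (RatFunc K)).toLinearMap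
      (IsFractionRing.injective K[X] (RatFunc K))
  have hex : ∀ z : Ω ⊗[K] RatFunc K, ∃ d : K[X], d ≠ 0 ∧ ∃ w, ι (1 ⊗ₜ d) * z = ι w := by
    intro z
    induction z with
    | zero => exact ⟨1, one_ne_zero, 0, by simp⟩
    | tmul w x =>
      refine ⟨x.denom, x.denom_ne_zero, w ⊗ₜ x.num, ?_⟩
      simp only [ι, Algebra.TensorProduct.map_tmul, Algebra.TensorProduct.tmul_mul_tmul, map_one,
        one_mul, AlgHom.id_apply]
      congr 1
      have := RatFunc.num_div_denom x
      rw [div_eq_iff (RatFunc.algebraMap_ne_zero x.denom_ne_zero)] at this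
      simp [this, mul_comm]
    | add x y hx hy =>
      obtain ⟨d, hd, v, hv⟩ := hx
      obtain ⟨e, he, w, hw⟩ := hy
      refine ⟨d * e, mul_ne_zero hd he, 1 ⊗ₜ e * v + 1 ⊗ₜ d * w, ?_⟩
      have : (1 : Ω) ⊗ₜ[K] (d * e) = 1 ⊗ₜ d * 1 ⊗ₜ e := by simp
      rw [this, map_add, map_mul, map_mul, map_mul, ← hv, ← hw]
      ring
  refine (isReduced_iff_pow_one_lt 2 one_lt_two).mpr fun z hz => ?_
  obtain ⟨d, hd, w, hw⟩ := hex z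
  have hw0 : w = 0 := by
    refine eq_zero_of_pow_eq_zero (n := 2) (hι ?_)
    rw [map_pow, ← hw, mul_pow, hz, mul_zero, map_zero]
  have hunit : IsUnit (ι (1 ⊗ₜ d)) := by
    have : ι (1 ⊗ₜ d) = (Algebra.TensorProduct.includeRight : RatFunc K →ₐ[K] Ω ⊗[K] RatFunc K)
        (algebraMap K[X] (RatFunc K) d) := by simp [ι]
    rw [this]
    exact (isUnit_iff_ne_zero.mpr (RatFunc.algebraMap_ne_zero hd)).map _
  rw [hw0, map_zero] at hw
  exact hunit.mul_right_eq_zero.mp hw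

lemma fibrePoly_fact {K : Type u} [Field K] {β γ a : K} (h2 : (2 : K) ≠ 0) (hβ : β ≠ 0)
    (ha : a ≠ 0) : Fact (∀ r : RatFunc K,
      r ^ 2 ≠ algebraMap K[X] (RatFunc K) (fibrePoly β γ a) + 0 * r) :=
  ⟨fun r hr => algebraMap_fibrePoly_ne (γ := γ) h2 hβ ha 1 r (by simpa using hr.symm)⟩

/-- The function field of the fibre at `a ≠ 0` is a regular extension of `K`. -/
lemma isRegularExtension_fibre {K : Type u} [Field K] {β γ a : K} (h2 : (2 : K) ≠ 0) (hβ : β ≠ 0)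
    (ha : a ≠ 0) [Fact (∀ r : RatFunc K,
      r ^ 2 ≠ algebraMap K[X] (RatFunc K) (fibrePoly β γ a) + 0 * r)] :
    IsRegularExtension K
      (QuadraticAlgebra (RatFunc K) (algebraMap K[X] (RatFunc K) (fibrePoly β γ a)) 0) where
  separable := by
    have := isGeometricallyReduced_ratFunc K
    refine isGeometricallyReduced_quadraticAlgebra h2 fun h0 => ?_
    exact algebraMap_fibrePoly_ne (γ := γ) h2 hβ ha 1 0 (by simpa using h0)
  algebraicClosure_eq := by
    rw [eq_bot_iff]
    intro x hx
    rw [IntermediateField.mem_bot]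
    exact mem_range_of_isAlgebraic_quadraticAlgebra h2 mem_range_of_isAlgebraic_ratFunc
      (algebraMap_fibrePoly_ne h2 hβ ha) x (mem_algebraicClosure_iff.mp hx)

/-- The pair `(X, ω)` is a solution in the function field. -/
lemma exists_sq_eq_of_isExistClosedIn {K : Type u} [Field K] {β γ a : K} {F : RatFunc K}
    (hF : algebraMap K[X] (RatFunc K) (fibrePoly β γ a) = F)
    (h : IsExistClosedIn K (QuadraticAlgebra (RatFunc K) F 0)) :
    ∃ x y : K, y ^ 2 = β * (x ^ 2 + γ) ^ 2 + a * x := by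
  let p : MvPolynomial (Fin 2) K := .X 1 ^ 2 -
    (.C β * (.X 0 ^ 2 + .C γ) ^ 2 + .C a * .X 0)
  obtain ⟨b, hb, -⟩ := h 2 {p} ∅
    ⟨![algebraMap (RatFunc K) _ RatFunc.X, QuadraticAlgebra.omega], by
      intro q hq
      rw [Finset.mem_singleton] at hq
      subst hq
      have hC : ∀ c : K, algebraMap K (QuadraticAlgebra (RatFunc K) F 0) c =
          algebraMap (RatFunc K) _ (algebraMap K[X] (RatFunc K) (C c)) := fun c => rfl
      have hω : (QuadraticAlgebra.omega : QuadraticAlgebra (RatFunc K) F 0) ^ 2 =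
          algebraMap (RatFunc K) _ F := by
        ext <;> simp [pow_two]
      simp only [p, map_sub, map_add, map_mul, map_pow, MvPolynomial.aeval_X,
        MvPolynomial.aeval_C, Matrix.cons_val_zero, Matrix.cons_val_one, hC]
      have hF' := congrArg (algebraMap (RatFunc K) (QuadraticAlgebra (RatFunc K) F 0)) hF
      simp only [fibrePoly, map_add, map_mul, map_pow] at hF'
      rw [hω, ← RatFunc.algebraMap_X]
      linear_combination -hF', by simp⟩
  refine ⟨b 0, b 1, ?_⟩
  have := hb p (by simp)
  simpa [p, sub_eq_zero] using this

end FieldTheory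

/-! ### Extending orderings to function fields of double covers. -/

section Orderings

/-- Every preordering of a field is contained in an ordering. -/
lemma RingPreordering.exists_isOrdering_ge {L : Type u} [Field L] (T : RingPreordering L) :
    ∃ Q : RingPreordering L, Q.IsOrdering ∧ T ≤ Q := by
  obtain ⟨Q, hTQ, hmax⟩ := zorn_le_nonempty_Ici₀ T (fun c hc hchain y hy => by
    have hdir : ∀ s ∈ c, ∀ t ∈ c, ∃ r ∈ c, s ≤ r ∧ t ≤ r := fun s hs t ht =>
      (hchain.total hs ht).elim (fun h => ⟨t, ht, h, le_rfl⟩) fun h => ⟨s, hs, le_rfl, h⟩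
    refine ⟨RingPreordering.mk' {x | ∃ s ∈ c, x ∈ s} ?_ ?_ ?_ ?_, fun s hs x hx => ⟨s, hs, hx⟩⟩
    · rintro x y ⟨s, hs, hx⟩ ⟨t, ht, hy⟩
      obtain ⟨r, hr, hsr, htr⟩ := hdir s hs t ht
      exact ⟨r, hr, add_mem (hsr hx) (htr hy)⟩
    · rintro x y ⟨s, hs, hx⟩ ⟨t, ht, hy⟩
      obtain ⟨r, hr, hsr, htr⟩ := hdir s hs t ht
      exact ⟨r, hr, mul_mem (hsr hx) (htr hy)⟩
    · exact fun x => ⟨y, hy, y.mul_self_mem x⟩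
    · rintro ⟨s, -, hs⟩
      exact s.neg_one_notMem hs) T le_rfl
  -- By maximality, `Q + Q y` is not a preordering when `y ∉ Q`, and the only axiom that can fail is
  -- `-1 ∉ Q + Q y`.
  have hadj : ∀ y : L, y ∉ Q → ∃ a ∈ Q, ∃ b ∈ Q, a + b * y = -1 := by
    intro y hy
    by_contra! hne
    let Q' : RingPreordering L := RingPreordering.mk' {x | ∃ a ∈ Q, ∃ b ∈ Q, a + b * y = x}
      (by
        rintro _ _ ⟨a, ha, b, hb, rfl⟩ ⟨c, hc, d, hd, rfl⟩
        exact ⟨a + c, add_mem ha hc, b + d, add_mem hb hd, by ring⟩)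
      (by
        rintro _ _ ⟨a, ha, b, hb, rfl⟩ ⟨c, hc, d, hd, rfl⟩
        exact ⟨a * c + b * d * (y * y),
          add_mem (mul_mem ha hc) (mul_mem (mul_mem hb hd) (Q.mul_self_mem y)),
          a * d + b * c, add_mem (mul_mem ha hd) (mul_mem hb hc), by ring⟩)
      (fun x => ⟨x * x, Q.mul_self_mem x, 0, zero_mem Q, by ring⟩)
      (by
        rintro ⟨a, ha, b, hb, h⟩
        exact hne a ha b hb h)
    have hQQ' : Q ≤ Q' := fun x hx => ⟨x, hx, 0, zero_mem Q, by ring⟩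
    exact hy (hmax hQQ' ⟨0, zero_mem Q, 1, one_mem Q, by ring⟩)
  have hmem : HasMemOrNegMem Q := ⟨fun x => by
    by_contra! h
    obtain ⟨a, ha, b, hb, hab⟩ := hadj x h.1
    obtain ⟨c, hc, d, hd, hcd⟩ := hadj (-x) h.2
    refine Q.neg_one_notMem ?_
    -- Multiply `1 + a = -b x` by `1 + c = d x`.
    have : (-1 : L) = a + c + a * c + b * d * (x * x) := by
      linear_combination -(1 + c) * hab + b * x * hcd
    rw [this]
    exact add_mem (add_mem (add_mem ha hc) (mul_mem ha hc))
      (mul_mem (mul_mem hb hd) (Q.mul_self_mem x))⟩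
  exact ⟨Q, { }, hTQ⟩

/-- An ordering extends to a field extension if `-1` is not a combination of squares with
nonnegative coefficients. -/
lemma RingPreordering.exists_extension {K L : Type u} [Field K] [Field L] [Algebra K L]
    (P : RingPreordering K) (hP : P.IsOrdering)
    (h : -1 ∉ AddSubmonoid.closure {y : L | ∃ p ∈ P, ∃ x : L, algebraMap K L p * x ^ 2 = y}) :
    ∃ Q : RingPreordering L, Q.IsOrdering ∧ ∀ a : K, algebraMap K L a ∈ Q ↔ a ∈ P := by
  set S := {y : L | ∃ p ∈ P, ∃ x : L, algebraMap K L p * x ^ 2 = y} with hS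
  let T : RingPreordering L := RingPreordering.mk' (AddSubmonoid.closure S)
    (fun hx hy => add_mem hx hy)
    (fun {x y} hx hy => by
      induction hx using AddSubmonoid.closure_induction with
      | zero => rw [zero_mul]; exact zero_mem _
      | add a b _ _ ha hb => rw [add_mul]; exact add_mem ha hb
      | mem a ha =>
        induction hy using AddSubmonoid.closure_induction with
        | zero => rw [mul_zero]; exact zero_mem _
        | add b c _ _ hb hc => rw [mul_add]; exact add_mem hb hc
        | mem b hb =>
          obtain ⟨p, hp, v, rfl⟩ := ha
          obtain ⟨q, hq, w, rfl⟩ := hb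
          exact AddSubmonoid.subset_closure
            ⟨p * q, mul_mem hp hq, v * w, by rw [map_mul]; ring⟩)
    (fun x => AddSubmonoid.subset_closure ⟨1, one_mem P, x, by rw [map_one]; ring⟩) h
  obtain ⟨Q, hQ, hTQ⟩ := T.exists_isOrdering_ge
  have hPQ : ∀ a ∈ P, algebraMap K L a ∈ Q := fun a ha =>
    hTQ (AddSubmonoid.subset_closure ⟨a, ha, 1, by ring⟩)
  refine ⟨Q, hQ, fun a => ⟨fun ha => ?_, hPQ a⟩⟩
  obtain h1 | h1 := mem_or_neg_mem P a
  · exact h1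
  · have h2 := hPQ _ h1
    rw [map_neg] at h2
    have h3 := RingPreordering.eq_zero_of_mem_of_neg_mem ha h2
    rw [map_eq_zero] at h3
    rw [h3]
    exact zero_mem P

/-- The linear order defined by an ordering of a field. -/
lemma RingPreordering.exists_linearOrder {K : Type u} [Field K] (P : RingPreordering K)
    (hP : P.IsOrdering) :
    ∃ _ : LinearOrder K, IsStrictOrderedRing K ∧ ∀ a : K, 0 ≤ a ↔ a ∈ P := by
  classical
  let i : LinearOrder K :=
    { le := fun a b => b - a ∈ P
      le_refl := fun a => by simp
      le_trans := fun a b c hab hbc => by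
        have := add_mem hbc hab
        rwa [sub_add_sub_cancel] at this
      le_antisymm := fun a b hab hba => by
        rw [← neg_sub] at hba
        exact (sub_eq_zero.mp (RingPreordering.eq_zero_of_mem_of_neg_mem hab hba)).symm
      le_total := fun a b => by
        have := mem_or_neg_mem P (b - a)
        rwa [neg_sub] at this
      toDecidableLE := fun _ _ => Classical.dec _ }
  have hle : ∀ a b : K, a ≤ b ↔ b - a ∈ P := fun _ _ => Iff.rfl
  have h0 : ∀ a : K, 0 ≤ a ↔ a ∈ P := fun a => by rw [hle, sub_zero]
  have h1 : IsOrderedAddMonoid K := 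
    { add_le_add_left := fun a b hab c => by
        rw [hle] at hab ⊢
        rwa [add_sub_add_right_eq_sub] }
  have h2 : ZeroLEOneClass K := ⟨(h0 1).mpr (one_mem P)⟩
  refine ⟨i, IsStrictOrderedRing.of_mul_pos fun a b ha hb => ?_, h0⟩
  refine lt_of_le_of_ne ((h0 _).mpr (mul_mem ((h0 a).mp ha.le) ((h0 b).mp hb.le))) ?_
  exact (mul_ne_zero ha.ne' hb.ne').symm

/-- An ordering extends to the quadratic extension given by a square root of a nonnegative
element. -/
lemma RingPreordering.exists_extension_quadraticAlgebra {K : Type u} [Field K]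
    (P : RingPreordering K) (hP : P.IsOrdering) {d : K} (hd : d ∈ P)
    [Fact (∀ r : K, r ^ 2 ≠ d + 0 * r)] :
    ∃ Q : RingPreordering (QuadraticAlgebra K d 0), Q.IsOrdering ∧
      ∀ a : K, algebraMap K (QuadraticAlgebra K d 0) a ∈ Q ↔ a ∈ P := by
  refine P.exists_extension hP fun h => ?_
  -- The rational part of `p(r + s√d)²` is `p(r² + d s²)`, which is nonnegative because `d` is.
  have key : ∀ y ∈ AddSubmonoid.closure {y : QuadraticAlgebra K d 0 | ∃ p ∈ P,
      ∃ x : QuadraticAlgebra K d 0, algebraMap K _ p * x ^ 2 = y}, y.re ∈ P := by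
    intro y hy
    induction hy using AddSubmonoid.closure_induction with
    | zero => exact zero_mem P
    | add a b _ _ ha hb => exact add_mem ha hb
    | mem a ha =>
      obtain ⟨p, hp, x, rfl⟩ := ha
      have : (algebraMap K (QuadraticAlgebra K d 0) p * x ^ 2).re =
          p * (x.re * x.re + d * (x.im * x.im)) := by
        simp [pow_two, mul_assoc]
      rw [this]
      exact mul_mem hp (add_mem (P.mul_self_mem _) (mul_mem hd (P.mul_self_mem _)))
  exact P.neg_one_notMem (by simpa [QuadraticAlgebra.re_one] using key _ h)

open Polynomial in
/-- A polynomial over an ordered field that takes a positive value takes nonnegative values at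
infinitely many points. -/
lemma infinite_setOf_eval_nonneg {K : Type u} [Field K] [LinearOrder K] [IsStrictOrderedRing K]
    (f : K[X]) (c : K) (hc : 0 < f.eval c) : {x : K | 0 ≤ f.eval x}.Infinite := by
  let _ := Preorder.topology K
  have : OrderTopology K := ⟨rfl⟩
  have hopen : IsOpen {x : K | 0 < f.eval x} := isOpen_lt continuous_const f.continuous
  exact (infinite_of_mem_nhds c (hopen.mem_nhds hc)).mono fun x hx => le_of_lt hx

open Polynomial in
/-- An ordering of `K` extends to `K(X)(√f)` if it extends to an extension of `K` in which `f` takes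
a positive value. -/
lemma RingPreordering.exists_extension_of_eval_pos {K K' : Type u} [Field K] [Field K']
    [Algebra K K'] (P : RingPreordering K) (hP : P.IsOrdering) (P' : RingPreordering K')
    (hP' : P'.IsOrdering) (hPP' : ∀ a : K, algebraMap K K' a ∈ P' ↔ a ∈ P) (f : K[X]) (c : K')
    (hc : aeval c f ∈ P') (hc0 : aeval c f ≠ 0) {F : RatFunc K}
    (hF : algebraMap K[X] (RatFunc K) f = F) [Fact (∀ r : RatFunc K, r ^ 2 ≠ F + 0 * r)] :
    ∃ Q : RingPreordering (QuadraticAlgebra (RatFunc K) F 0), Q.IsOrdering ∧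
      ∀ a : K, algebraMap K (QuadraticAlgebra (RatFunc K) F 0) a ∈ Q ↔ a ∈ P := by
  refine P.exists_extension hP fun h => ?_
  -- Up to a square denominator `D²`, the rational part of a sum of terms `p(r + s√f)²` is a
  -- polynomial that is nonnegative wherever `f` is. For `-1` that polynomial is `-D²`, so `D`
  -- vanishes at the infinitely many points near `c` where `f ≥ 0`, contradicting `D ≠ 0`.
  have key : ∀ y ∈ AddSubmonoid.closure {y : QuadraticAlgebra (RatFunc K) F 0 | ∃ p ∈ P,
      ∃ x : QuadraticAlgebra (RatFunc K) F 0, algebraMap K _ p * x ^ 2 = y},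
        ∃ D N : K[X], D ≠ 0 ∧ y.re * algebraMap _ _ (D ^ 2) = algebraMap K[X] (RatFunc K) N ∧
          ∀ x : K', aeval x f ∈ P' → aeval x N ∈ P' := by
    intro y hy
    induction hy using AddSubmonoid.closure_induction with
    | zero => exact ⟨1, 0, one_ne_zero, by simp, fun x _ => by simp⟩
    | add a b _ _ ha hb =>
      obtain ⟨D, N, hD, h1, h2⟩ := ha
      obtain ⟨D', N', hD', h1', h2'⟩ := hb
      refine ⟨D * D', N * D' ^ 2 + N' * D ^ 2, mul_ne_zero hD hD', ?_, fun x hx => ?_⟩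
      · simp only [QuadraticAlgebra.re_add, map_add, map_mul, map_pow] at h1 h1' ⊢
        rw [← h1, ← h1']
        ring
      · simp only [map_add, map_mul, map_pow]
        exact add_mem (mul_mem (h2 x hx) (P'.pow_two_mem _))
          (mul_mem (h2' x hx) (P'.pow_two_mem _))
    | mem a ha =>
      obtain ⟨p, hp, x, rfl⟩ := ha
      have hre : (algebraMap K (QuadraticAlgebra (RatFunc K) F 0) p * x ^ 2).re =
          algebraMap K (RatFunc K) p * (x.re ^ 2 + F * x.im ^ 2) := by
        rw [IsScalarTower.algebraMap_apply K (RatFunc K)]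
        simp [pow_two, mul_assoc]
      obtain ⟨A, B, D, hD, hA, hB⟩ : ∃ A B D : K[X], D ≠ 0 ∧
          x.re * algebraMap _ _ D = algebraMap K[X] (RatFunc K) A ∧
            x.im * algebraMap _ _ D = algebraMap K[X] (RatFunc K) B := by
        refine ⟨x.re.num * x.im.denom, x.im.num * x.re.denom, x.re.denom * x.im.denom,
          mul_ne_zero x.re.denom_ne_zero x.im.denom_ne_zero, ?_, ?_⟩
        · have := RatFunc.num_div_denom x.re
          rw [div_eq_iff (RatFunc.algebraMap_ne_zero x.re.denom_ne_zero)] at this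
          rw [map_mul, map_mul, this]
          ring
        · have := RatFunc.num_div_denom x.im
          rw [div_eq_iff (RatFunc.algebraMap_ne_zero x.im.denom_ne_zero)] at this
          rw [map_mul, map_mul, this]
          ring
      refine ⟨D, C p * (A ^ 2 + f * B ^ 2), hD, ?_, fun x hx => ?_⟩
      · rw [hre, IsScalarTower.algebraMap_apply K K[X] (RatFunc K), Polynomial.algebraMap_eq]
        simp only [map_add, map_mul, map_pow, ← hA, ← hB, hF]
        ring
      · simp only [map_add, map_mul, map_pow, aeval_C]
        exact mul_mem ((hPP' p).mpr hp) (add_mem (P'.pow_two_mem _)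
          (mul_mem hx (P'.pow_two_mem _)))
  obtain ⟨D, N, hD, hN, hpos⟩ := key _ h
  have hND : N = -D ^ 2 := by
    apply IsFractionRing.injective K[X] (RatFunc K)
    rw [← hN]
    simp [QuadraticAlgebra.re_one]
  obtain ⟨i, hi, hle⟩ := P'.exists_linearOrder hP'
  have hinf := infinite_setOf_eval_nonneg (f.map (algebraMap K K')) c (by
    rw [eval_map_algebraMap]
    exact lt_of_le_of_ne ((hle _).mpr hc) hc0.symm)
  refine hD ((Polynomial.map_eq_zero (algebraMap K K')).mp
    (eq_zero_of_infinite_isRoot (D.map (algebraMap K K')) (hinf.mono fun x hx => ?_)))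
  have h1 := hpos x ((hle _).mp (by
    have := hx
    rwa [Set.mem_ofPred_eq, eval_map_algebraMap] at this))
  rw [hND, map_neg, map_pow] at h1
  have h2 := RingPreordering.eq_zero_of_mem_of_neg_mem (P'.pow_two_mem (aeval x D)) h1
  change eval x _ = 0
  rw [eval_map_algebraMap]
  exact pow_eq_zero_iff two_ne_zero |>.mp h2

end Orderings

/-! ### Choice of the parameters and conclusion. -/

section Main

/-- This makes distinct orderings incomparable, so one of them has an element outside the other. -/
lemma RingPreordering.eq_of_le_of_isOrdering {K : Type u} [Field K] {P Q : RingPreordering K}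
    (hP : P.IsOrdering) (h : P ≤ Q) : P = Q := by
  refine le_antisymm h fun x hx => ?_
  obtain h1 | h1 := mem_or_neg_mem P x
  · exact h1
  · rw [RingPreordering.eq_zero_of_mem_of_neg_mem hx (h h1)]
    exact zero_mem P

/-- The family of double covers has rational image `K \ {0}` as soon as its central fibre has no
rational point and the other fibres have one. -/
lemma exists_proper_of_fibres {K : Type u} [Field K] (β γ : K) (hβ : ¬ IsSquare β)
    (hγ : ¬ IsSquare (-γ))
    (h : ∀ a : K, a ≠ 0 → ∃ x y : K, y ^ 2 = β * (x ^ 2 + γ) ^ 2 + a * x) :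
    ∃ (V : Scheme.{u}) (s : V ⟶ Spec (CommRingCat.of K)) (f : V ⟶ affineLine K),
      IsKVariety s ∧ f ≫ affineLineOver K = s ∧ IsProper f ∧
        rationalImage s f = {a : K | a ≠ 0} := by
  refine ⟨_, _, coverToLine β γ, coverToLine_isKVariety β γ, rfl, inferInstance, ?_⟩
  rw [rationalImage_coverToLine]
  ext a
  constructor
  · rintro ⟨u, v, y, huv, hy⟩ rfl
    -- A zero would force `-γ = (u / v)²`, or `u = v = 0`.
    have hne : u ^ 2 + γ * v ^ 2 ≠ 0 := by
      intro h0
      by_cases hv : v = 0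
      · subst hv
        simp at h0 huv
        exact huv h0
      · exact hγ ⟨u / v, by field_simp; linear_combination -h0⟩
    exact hβ ⟨y / (u ^ 2 + γ * v ^ 2), by field_simp; linear_combination -hy⟩
  · intro ha
    obtain ⟨x, y, hxy⟩ := h a ha
    exact ⟨x, 1, y, Or.inr one_ne_zero, by simpa using hxy⟩

lemma exists_point_of_isPAC {K : Type u} [Field K] (hK : IsPAC K) (h2 : (2 : K) ≠ 0) {β γ a : K}
    (hβ : β ≠ 0) (ha : a ≠ 0) : ∃ x y : K, y ^ 2 = β * (x ^ 2 + γ) ^ 2 + a * x :=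
  have := fibrePoly_fact (γ := γ) h2 hβ ha
  exists_sq_eq_of_isExistClosedIn rfl (hK _ (isRegularExtension_fibre h2 hβ ha))

/-- If `-β` is not a square, every ordering of `K` extends to the function field of the fibre at
`a ≠ 0`. -/
lemma orderingsExtend_fibre {K : Type u} [Field K] {β a : K} (hβ : ¬ IsSquare (-β))
    (hβ0 : β ≠ 0) (ha : a ≠ 0) {F : RatFunc K}
    (hF : algebraMap _ _ (fibrePoly β β a) = F) [Fact (∀ r : RatFunc K, r ^ 2 ≠ F + 0 * r)] :
    OrderingsExtend K (QuadraticAlgebra (RatFunc K) F 0) := by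
  intro P hP
  obtain hmem | hmem := mem_or_neg_mem P β
  -- If `β` is positive, so is the value `β³` at `0`.
  · have : Polynomial.aeval 0 (fibrePoly β β a) = β * (β * β) := by
      rw [Polynomial.coe_aeval_eq_eval, eval_fibrePoly]
      ring
    refine P.exists_extension_of_eval_pos hP P hP (fun _ => Iff.rfl) _ 0 ?_ ?_ hF
    · rw [this]
      exact mul_mem hmem (P.mul_self_mem _)
    · rw [this]
      simp [hβ0]
  -- If `-β` is positive, extend the ordering to `K(ω)` with `ω² = -β`. The values at `±ω` are
  -- `±aω`, and one of these is positive.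
  · have hfact : Fact (∀ r : K, r ^ 2 ≠ -β + 0 * r) :=
      ⟨fun r hr => hβ ⟨r, by linear_combination -hr⟩⟩
    obtain ⟨P', hP', hPP'⟩ := P.exists_extension_quadraticAlgebra hP hmem
    let ω : QuadraticAlgebra K (-β) 0 := QuadraticAlgebra.omega
    have hω : ω ^ 2 = -algebraMap K _ β := by ext <;> simp [ω, pow_two]
    have haω : algebraMap K (QuadraticAlgebra K (-β) 0) a * ω ≠ 0 := by
      refine mul_ne_zero (by simpa using ha) fun h0 => ?_
      have := congrArg QuadraticAlgebra.im h0
      simp [ω] at this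
    have key : ∀ c : QuadraticAlgebra K (-β) 0, c ^ 2 = -algebraMap K _ β →
        Polynomial.aeval c (fibrePoly β β a) = algebraMap K _ a * c := by
      intro c hc
      simp [fibrePoly, hc]
    obtain h1 | h1 := mem_or_neg_mem P' (algebraMap K (QuadraticAlgebra K (-β) 0) a * ω)
    · refine P.exists_extension_of_eval_pos hP P' hP' hPP' _ ω ?_ ?_ hF
      · rwa [key _ hω]
      · rwa [key _ hω]
    · have hω' : (-ω) ^ 2 = -algebraMap K _ β := by rw [neg_sq, hω]
      refine P.exists_extension_of_eval_pos hP P' hP' hPP' _ (-ω) ?_ ?_ hF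
      · rwa [key _ hω', mul_neg]
      · rw [key _ hω', mul_neg]
        exact neg_ne_zero.mpr haω

/-- A pseudofinite field of characteristic different from two has a nonsquare. -/
lemma IsPseudofinite.exists_not_isSquare {K : Type u} [Field K] (hK : IsPseudofinite K)
    (h2 : (2 : K) ≠ 0) : ∃ β : K, ¬ IsSquare β := by
  by_contra! hsq
  obtain ⟨E, hE, -⟩ := hK.existsUnique_extension 2 two_pos
  obtain ⟨x, hx⟩ : ∃ x : E, x ∉ (⊥ : Subalgebra K E) := by
    by_contra! h
    have h1 : (⊥ : Subalgebra K E) = ⊤ := eq_top_iff.mpr fun x _ => h x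
    rw [Subalgebra.bot_eq_top_iff_finrank_eq_one] at h1
    omega
  have : FiniteDimensional K E := Module.finite_of_finrank_pos (by omega)
  have hdeg : (minpoly K x).degree ≤ 2 :=
    Polynomial.degree_le_of_natDegree_le ((minpoly.natDegree_le x).trans_eq hE)
  obtain ⟨a, b, c, habc⟩ : ∃ a b c : K, minpoly K x =
      Polynomial.C a * Polynomial.X ^ 2 + Polynomial.C b * Polynomial.X + Polynomial.C c :=
    ⟨_, _, _, Polynomial.eq_quadratic_of_degree_le_two hdeg⟩
  have hroot := minpoly.aeval K x
  rw [habc] at hroot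
  simp only [map_add, map_mul, map_pow, Polynomial.aeval_C, Polynomial.aeval_X] at hroot
  have hmem : ∀ u v : K, u ≠ 0 → algebraMap K E u * x = algebraMap K E v → False := by
    intro u v hu huv
    refine hx (Algebra.mem_bot.mpr ⟨u⁻¹ * v, ?_⟩)
    rw [map_mul, ← huv, ← mul_assoc, ← map_mul, inv_mul_cancel₀ hu, map_one, one_mul]
  by_cases ha : a = 0
  · subst ha
    by_cases hb : b = 0
    · subst hb
      simp only [map_zero, zero_mul, zero_add, map_eq_zero] at hroot
      subst hroot
      exact minpoly.ne_zero (Algebra.IsIntegral.isIntegral (R := K) x) (by simpa using habc)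
    · refine hmem b (-c) hb ?_
      rw [map_zero] at hroot
      rw [map_neg]
      linear_combination hroot
  -- A square discriminant puts `x` in `K` by the quadratic formula, as `2a ≠ 0`.
  · obtain ⟨s, hs⟩ := hsq (b ^ 2 - 4 * a * c)
    have hs' := congrArg (algebraMap K E) hs
    simp only [map_sub, map_mul, map_pow, map_ofNat] at hs'
    have hprod : (algebraMap K E (2 * a) * x + algebraMap K E b - algebraMap K E s) *
        (algebraMap K E (2 * a) * x + algebraMap K E b + algebraMap K E s) = 0 := by
      simp only [map_mul, map_ofNat]
      linear_combination 4 * algebraMap K E a * hroot + hs'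
    obtain h | h := mul_eq_zero.mp hprod
    · refine hmem (2 * a) (s - b) (mul_ne_zero h2 ha) ?_
      rw [map_sub]
      linear_combination h
    · refine hmem (2 * a) (-s - b) (mul_ne_zero h2 ha) ?_
      rw [map_sub, map_neg]
      linear_combination h

theorem mainTheorem12 (K : Type u) [Field K]
    (hK : (IsPseudofinite K ∧ ringChar K ≠ 2) ∨
      (IsPAC K ∧ ringChar K ≠ 2 ∧ ∃ β : K, ¬ IsSquare β) ∨
      (IsPRC K ∧ ∃ P Q : RingPreordering K, P.IsOrdering ∧ Q.IsOrdering ∧ P ≠ Q)) :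
    ∃ (V : Scheme.{u}) (s : V ⟶ Spec (CommRingCat.of K)) (f : V ⟶ affineLine K),
      IsKVariety s ∧ f ≫ affineLineOver K = s ∧ IsProper f ∧
        rationalImage s f = {a : K | a ≠ 0} := by
  have hPAC : IsPAC K → (2 : K) ≠ 0 → (∃ β : K, ¬ IsSquare β) →
      ∃ (V : Scheme.{u}) (s : V ⟶ Spec (CommRingCat.of K)) (f : V ⟶ affineLine K),
        IsKVariety s ∧ f ≫ affineLineOver K = s ∧ IsProper f ∧
          rationalImage s f = {a : K | a ≠ 0} := by
    rintro hK h2 ⟨β, hβ⟩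
    have hβ0 : β ≠ 0 := fun h => hβ (h ▸ IsSquare.zero)
    -- With `γ = -β`, both nonsquare conditions say that `β` is not a square.
    exact exists_proper_of_fibres β (-β) hβ (by rwa [neg_neg]) fun a ha =>
      exists_point_of_isPAC hK h2 hβ0 ha
  obtain ⟨hK, hchar⟩ | ⟨hK, hchar, hβ⟩ | ⟨hK, P, Q, hP, hQ, hPQ⟩ := hK
  · have h2 := Ring.two_ne_zero hchar
    exact hPAC hK.pac h2 (hK.exists_not_isSquare h2)
  · exact hPAC hK (Ring.two_ne_zero hchar) hβ
  · have h2 : (2 : K) ≠ 0 := by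
      intro h
      apply P.neg_one_notMem
      rw [show (-1 : K) = 1 by linear_combination -h]
      exact one_mem P
    obtain ⟨β, hβP, hβQ⟩ : ∃ β ∈ P, β ∉ Q := by
      by_contra! h
      exact hPQ (RingPreordering.eq_of_le_of_isOrdering hP h)
    have hβ0 : β ≠ 0 := fun h => hβQ (h ▸ zero_mem Q)
    -- Squares lie in every ordering, so `Q` shows that `β` is not a square and `P` that `-β` is
    -- not.
    have hβ : ¬ IsSquare β := fun h => hβQ (Q.mem_of_isSquare h)
    have hβ' : ¬ IsSquare (-β) := fun h =>
      hβ0 (RingPreordering.eq_zero_of_mem_of_neg_mem hβP (P.mem_of_isSquare h))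
    refine exists_proper_of_fibres β β hβ hβ' fun a ha => ?_
    have := fibrePoly_fact (γ := β) h2 hβ0 ha
    exact exists_sq_eq_of_isExistClosedIn rfl
      (hK _ (isRegularExtension_fibre h2 hβ0 ha) (orderingsExtend_fibre hβ' hβ0 ha rfl))

end Main
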